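/- A Büchi game $G=(V,E,\mathit{Own},\mathit{Fin},v_{\mathsf I})$ consists of a set $V$ of nodes (coded as natural numbers), an edge relation $E\subseteq V\times V$, sets $\mathit{Own},\mathit{Fin}\subseteq V$ and a starting node $v_{\mathsf I}\in V$; it is recursive if $V,E,\mathit{Own},\mathit{Fin}$ are decidable. A play starts in $v_0=v_{\mathsf I}$; at a node $v_i\in\mathit{Own}$ player $0$, and at any other node player $1$, chooses $v_{i+1}$ with $(v_i,v_{i+1})\in E$. A player who has to move but cannot do so loses, and player $0$ wins an infinite play iff $v_i\in\mathit{Fin}$ for infinitely many $i$. The recursive Büchi game problem is to decide, given a recursive Büchi game by programs (Turing machines or, equivalently, codes of partial recursive functions) that decide $V,E,\mathit{Own},\mathit{Fin}$, together with $v_{\mathsf I}$, whether player $0$ has a winning strategy. Theorem. The recursive Büchi game problem is hard, under computable many-one reductions, for the class $B\Sigma^1_1$ of all finite Boolean combinations of $\Sigma^1_1$ sets of natural numbers, where $A\subseteq\mathbb N$ is $\Sigma^1_1$ if there are a $k$ and a first-order formula $\varphi$ of arithmetic with $k$ additional unary function variables such that $n\in A\iff\exists F_1,\dots,F_k\colon\mathbb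 N\to\mathbb N\ \ (\mathbb N,0,1,+,\cdot,F_1,\dots,F_k)\models\varphi(n)$ for all $n$. That is, for every $A\in B\Sigma^1_1$ there is a computable function $f$ such that, for every $n\in\mathbb N$, $f(n)$ is a description by programs of a recursive Büchi game, and $n\in A$ if and only if player $0$ has a winning strategy in the game described by $f(n)$. -/

import Mathlib

open FirstOrder

/-! ## Büchi games -/

/-- A Büchi game whose nodes are (coded as) natural numbers: a set `node` of nodes, an edge
relation between nodes, the set `own` of the nodes where player 0 moves (player 1 moves at all
other nodes), the set `fin` of accepting nodes and a starting node. -/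
structure BuchiGame where
  node : Set ℕ
  edge : ℕ → ℕ → Prop
  own : Set ℕ
  fin : Set ℕ
  start : ℕ
  edge_mem : ∀ u v, edge u v → u ∈ node ∧ v ∈ node
  own_subset : own ⊆ node
  fin_subset : fin ⊆ node
  start_mem : start ∈ node

namespace BuchiGame

variable (G : BuchiGame)

/-- `v 0, …, v n` is a (not necessarily complete) finite play. -/
def IsFinitePlay (v : ℕ → ℕ) (n : ℕ) : Prop :=
  v 0 = G.start ∧ ∀ i < n, G.edge (v i) (v (i + 1))

/-- `v 0, v 1, …` is an infinite play. -/
def IsInfinitePlay (v : ℕ → ℕ) : Prop :=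
  v 0 = G.start ∧ ∀ i, G.edge (v i) (v (i + 1))

/-- The history `[v 0, …, v n]`. -/
def history (v : ℕ → ℕ) (n : ℕ) : List ℕ :=
  (List.range (n + 1)).map v

/-- A strategy of player 0 maps histories to nodes. Whenever player 0 has to move and is able to
move, the node chosen has to be a successor of the current node. -/
def IsStrategy (σ : List ℕ → ℕ) : Prop :=
  ∀ v n, G.IsFinitePlay v n → v n ∈ G.own → (∃ w, G.edge (v n) w) →
    G.edge (v n) (σ (history v n))

/-- At step `i` (from `v i` to `v (i + 1)`) the play `v` conforms to the strategy `σ`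
of player 0. -/
def ConformsAt (σ : List ℕ → ℕ) (v : ℕ → ℕ) (i : ℕ) : Prop :=
  v i ∈ G.own → v (i + 1) = σ (history v i)

/-- The strategy `σ` is winning for player 0: every finite play conforming to `σ` that ends in a
node without successors ends in a node of player 1, and every infinite play conforming to `σ`
visits `fin` infinitely often. -/
def IsWinning (σ : List ℕ → ℕ) : Prop :=
  (∀ v n, G.IsFinitePlay v n → (∀ i < n, G.ConformsAt σ v i) →
    (¬ ∃ w, G.edge (v n) w) → v n ∉ G.own) ∧
  (∀ v, G.IsInfinitePlay v → (∀ i, G.ConformsAt σ v i) →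
    ∃ᶠ i in Filter.atTop, v i ∈ G.fin)

/-- Player 0 has a winning strategy. -/
def PlayerZeroWins : Prop :=
  ∃ σ : List ℕ → ℕ, G.IsStrategy σ ∧ G.IsWinning σ

end BuchiGame

/-! ## Recursive Büchi games, given by programs -/

/-- The program `c` halts on every input and decides the set `S`. -/
def Decides (c : Nat.Partrec.Code) (S : Set ℕ) : Prop :=
  ∀ n, (n ∈ S → c.eval n = Part.some 1) ∧ (n ∉ S → c.eval n = Part.some 0)

/-- Finite descriptions of games: programs for the node set, the edge relation, the set `own` and
the set `fin`, together with the starting node. -/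
abbrev GameDescription : Type :=
  Nat.Partrec.Code × Nat.Partrec.Code × Nat.Partrec.Code × Nat.Partrec.Code × ℕ

/-- The description `d` describes the Büchi game `G` (which then is a recursive Büchi game). -/
def Describes (d : GameDescription) (G : BuchiGame) : Prop :=
  Decides d.1 G.node ∧
  Decides d.2.1 {p | G.edge p.unpair.1 p.unpair.2} ∧
  Decides d.2.2.1 G.own ∧
  Decides d.2.2.2.1 G.fin ∧
  d.2.2.2.2 = G.start

/-- `d` describes some recursive Büchi game. -/
def IsRecursiveBuchiGame (d : GameDescription) : Prop :=
  ∃ G : BuchiGame, Describes d G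

/-- The recursive Büchi game problem: `d` describes a recursive Büchi game in which player 0 has a
winning strategy. -/
def RBGProblem (d : GameDescription) : Prop :=
  ∃ G : BuchiGame, Describes d G ∧ G.PlayerZeroWins

/-! ## Boolean combinations of lightface `Σ¹₁` sets -/

/-- Function symbols of arithmetic, extended by `k` unary function variables. -/
inductive ArithFunc (k : ℕ) : ℕ → Type
  | zero : ArithFunc k 0
  | one : ArithFunc k 0
  | add : ArithFunc k 2
  | mul : ArithFunc k 2
  | var (i : Fin k) : ArithFunc k 1

/-- The language of first-order arithmetic with equality, extended by `k` unary function
variables. -/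
abbrev arithLanguage (k : ℕ) : Language where
  Functions := ArithFunc k
  Relations := fun _ => Empty

/-- The standard model of arithmetic, with the function variables interpreted by `F`. -/
@[reducible] def arithStructure {k : ℕ} (F : Fin k → ℕ → ℕ) : (arithLanguage k).Structure ℕ where
  funMap := fun {_} g x =>
    match g, x with
    | ArithFunc.zero, _ => 0
    | ArithFunc.one, _ => 1
    | ArithFunc.add, x => x 0 + x 1
    | ArithFunc.mul, x => x 0 * x 1
    | ArithFunc.var i, x => F i (x 0)
  RelMap := fun {_} r _ => r.elim

/-- `A` is (lightface) `Σ¹₁`: it is defined over the natural numbers by existential quantifiers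
over functions `ℕ → ℕ`, followed by a first-order formula of arithmetic. -/
def IsSigmaOneOne (A : Set ℕ) : Prop :=
  ∃ (k : ℕ) (φ : (arithLanguage k).Formula Unit), ∀ n : ℕ,
    n ∈ A ↔ ∃ F : Fin k → ℕ → ℕ,
      @Language.Formula.Realize (arithLanguage k) ℕ (arithStructure F) Unit φ (fun _ => n)

/-- The class of all (finite) Boolean combinations of `Σ¹₁` sets. -/
def BooleanSigmaOneOne : BooleanSubalgebra (Set ℕ) :=
  BooleanSubalgebra.closure {A : Set ℕ | IsSigmaOneOne A}

open Filter

/-! ## A normal form for `Σ¹₁` sets -/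

/-! Every `Σ¹₁` set has a tree normal form: `n ∈ A` iff some `h` satisfies `R (n, initialSegment h
m)` for all `m`, with `R` primitive recursive (`IsSigmaOneOne.exists_primrecPred`). The arithmetical
matrix is Skolemized: function quantifiers, Skolem functions and moduli of stabilization all merge
into the single function `h`.

Such a set becomes a solitaire game in which one player extends a finite sequence and must keep `R`
true. If player 0 builds and all nodes accept, player 0 wins iff a branch exists, which gives `A`.
If player 1 builds and no node accepts, player 0 wins iff no branch exists, which gives the
complement. A fresh root where player 0 (player 1) chooses between two games yields unions
(intersections). By De Morgan, carrying `A` and `Aᶜ` through the induction together covers all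
Boolean combinations (`gameReducible_of_mem_booleanSigmaOneOne`).

Determinacy is never invoked: `GameReducible` provides, for each `n`, a positional winning strategy
of whichever player should win, and `positionallyWins_of_components` propagates these through
choices. Only the edge relation depends on `n`, so the s-m-n theorem produces the programs
computably. -/

/-- The initial segment `[f 0, …, f m]` of `f`. -/
def initialSegment (f : ℕ → ℕ) (m : ℕ) : List ℕ :=
  (List.range (m + 1)).map f

@[simp] theorem length_initialSegment (f : ℕ → ℕ) (m : ℕ) :
    (initialSegment f m).length = m + 1 := by
  simp [initialSegment]

theorem getD_initialSegment {f : ℕ → ℕ} {m i : ℕ} (h : i ≤ m) :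
    (initialSegment f m).getD i 0 = f i := by
  simp [initialSegment, List.getD, Nat.lt_succ_of_le h]

theorem map_initialSegment (g f : ℕ → ℕ) (m : ℕ) :
    (initialSegment f m).map g = initialSegment (fun i => g (f i)) m := by
  simp [initialSegment, Function.comp_def]

theorem headI_initialSegment (f : ℕ → ℕ) (m : ℕ) : (initialSegment f m).headI = f 0 := by
  simp [initialSegment, List.range_succ_eq_map]

theorem map_range_getD_initialSegment {f e : ℕ → ℕ} {l m : ℕ} (h : ∀ i ≤ l, e i ≤ m) :
    (List.range (l + 1)).map (fun i => (initialSegment f m).getD (e i) 0) =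
      initialSegment (fun i => f (e i)) l := by
  refine List.map_congr_left fun i hi => ?_
  exact getD_initialSegment (h i (Nat.lt_succ_iff.1 (List.mem_range.1 hi)))

/-- The relation `P` between finite tuples of numbers and functions is a projection of a closed
set with a primitive recursive tree. -/
def HasClosedForm (P : List ℕ → (ℕ → ℕ) → Prop) : Prop :=
  ∃ R : List ℕ × List ℕ × List ℕ → Prop, PrimrecPred R ∧
    ∀ x f, P x f ↔ ∃ g, ∀ m, R (x, initialSegment f m, initialSegment g m)

namespace HasClosedForm

variable {P Q : List ℕ → (ℕ → ℕ) → Prop}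

theorem congr (hP : HasClosedForm P) (h : ∀ x f, Q x f ↔ P x f) : HasClosedForm Q := by
  obtain ⟨R, hR, hPR⟩ := hP
  exact ⟨R, hR, fun x f => (h x f).trans (hPR x f)⟩

/-- The value `g 0` of the witness is a guess of a stage from which `r` is correct, and earlier
stages are exempt from the test. A wrong guess is harmless: a single late enough stage already
forces `P`. -/
theorem of_eventually {r : List ℕ × List ℕ → Prop} (hr : PrimrecPred r)
    (h : ∀ x f, ∀ᶠ m in atTop, r (x, initialSegment f m) ↔ P x f) : HasClosedForm P := by
  refine ⟨fun p => p.2.1.length ≤ p.2.2.headI ∨ r (p.1, p.2.1), ?_, fun x f => ?_⟩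
  · exact .or (Primrec.nat_le.comp (Primrec.list_length.comp (Primrec.fst.comp Primrec.snd))
      (Primrec.list_headI.comp (Primrec.snd.comp Primrec.snd)))
      (hr.comp (Primrec.fst.pair (Primrec.fst.comp Primrec.snd)))
  · obtain ⟨N, hN⟩ := eventually_atTop.1 (h x f)
    simp only [length_initialSegment, headI_initialSegment]
    constructor
    · intro hP
      refine ⟨fun _ => N, fun m => ?_⟩
      rcases lt_or_ge m N with hm | hm
      · exact Or.inl hm
      · exact Or.inr ((hN m hm).2 hP)
    · rintro ⟨g, hg⟩
      rcases hg (max N (g 0)) with h' | h'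
      · have := le_max_right N (g 0)
        omega
      · exact (hN _ (le_max_left _ _)).1 h'

theorem and (hP : HasClosedForm P) (hQ : HasClosedForm Q) :
    HasClosedForm fun x f => P x f ∧ Q x f := by
  obtain ⟨R, hR, hPR⟩ := hP
  obtain ⟨S, hS, hQS⟩ := hQ
  refine ⟨fun p => R (p.1, p.2.1, p.2.2.map fun a => a.unpair.1) ∧
    S (p.1, p.2.1, p.2.2.map fun a => a.unpair.2), ?_, fun x f => ?_⟩
  · have h1 : Primrec₂ fun (_ : List ℕ × List ℕ × List ℕ) (a : ℕ) => a.unpair.1 :=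
      Primrec.fst.comp (Primrec.unpair.comp Primrec.snd)
    have h2 : Primrec₂ fun (_ : List ℕ × List ℕ × List ℕ) (a : ℕ) => a.unpair.2 :=
      Primrec.snd.comp (Primrec.unpair.comp Primrec.snd)
    have hs : Primrec fun p : List ℕ × List ℕ × List ℕ => p.2.2 := Primrec.snd.comp Primrec.snd
    have hf : Primrec fun p : List ℕ × List ℕ × List ℕ => p.2.1 := Primrec.fst.comp Primrec.snd
    exact .and (hR.comp (Primrec.fst.pair (hf.pair (Primrec.list_map hs h1))))
      (hS.comp (Primrec.fst.pair (hf.pair (Primrec.list_map hs h2))))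
  · simp only [map_initialSegment, hPR, hQS]
    constructor
    · rintro ⟨⟨g, hg⟩, g', hg'⟩
      exact ⟨fun i => Nat.pair (g i) (g' i), fun m => by simpa using ⟨hg m, hg' m⟩⟩
    · rintro ⟨g, hg⟩
      exact ⟨⟨_, fun m => (hg m).1⟩, _, fun m => (hg m).2⟩

theorem exists_cons (hP : HasClosedForm P) : HasClosedForm fun x f => ∃ y, P (y :: x) f := by
  obtain ⟨R, hR, hPR⟩ := hP
  refine ⟨fun p => R (p.2.2.headI.unpair.1 :: p.1, p.2.1, p.2.2.map fun a => a.unpair.2),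
    ?_, fun x f => ?_⟩
  · have h2 : Primrec₂ fun (_ : List ℕ × List ℕ × List ℕ) (a : ℕ) => a.unpair.2 :=
      Primrec.snd.comp (Primrec.unpair.comp Primrec.snd)
    have hs : Primrec fun p : List ℕ × List ℕ × List ℕ => p.2.2 := Primrec.snd.comp Primrec.snd
    have hf : Primrec fun p : List ℕ × List ℕ × List ℕ => p.2.1 := Primrec.fst.comp Primrec.snd
    exact hR.comp ((Primrec.list_cons.comp
      (Primrec.fst.comp (Primrec.unpair.comp (Primrec.list_headI.comp hs))) Primrec.fst).pair
      (hf.pair (Primrec.list_map hs h2)))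
  · simp only [map_initialSegment, headI_initialSegment, hPR]
    constructor
    · rintro ⟨y, g, hg⟩
      exact ⟨fun i => Nat.pair y (g i), fun m => by simpa using hg m⟩
    · rintro ⟨g, hg⟩
      exact ⟨_, _, hg⟩

/-- Skolemization: the witnesses for all `y` are interleaved as `g (Nat.pair y i)`. Stage `Nat.pair
y l` carries out the test of stage `l` for `y`; it sees enough of both functions because `i ≤ l`
gives `i ≤ Nat.pair y l` and `Nat.pair y i ≤ Nat.pair y l`. -/
theorem forall_cons (hP : HasClosedForm P) : HasClosedForm fun x f => ∀ y, P (y :: x) f := by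
  obtain ⟨R, hR, hPR⟩ := hP
  refine ⟨fun p => R ((p.2.1.length - 1).unpair.1 :: p.1,
    (List.range ((p.2.1.length - 1).unpair.2 + 1)).map (fun i => p.2.1.getD i 0),
    (List.range ((p.2.1.length - 1).unpair.2 + 1)).map
      (fun i => p.2.2.getD (Nat.pair (p.2.1.length - 1).unpair.1 i) 0)), ?_, fun x f => ?_⟩
  · have hs : Primrec fun p : List ℕ × List ℕ × List ℕ => p.2.2 := Primrec.snd.comp Primrec.snd
    have hf : Primrec fun p : List ℕ × List ℕ × List ℕ => p.2.1 := Primrec.fst.comp Primrec.snd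
    have hu : Primrec fun p : List ℕ × List ℕ × List ℕ => (p.2.1.length - 1).unpair :=
      Primrec.unpair.comp (Primrec.nat_sub.comp (Primrec.list_length.comp hf) (Primrec.const 1))
    have hr : Primrec fun p : List ℕ × List ℕ × List ℕ =>
        List.range ((p.2.1.length - 1).unpair.2 + 1) :=
      Primrec.list_range.comp (Primrec.succ.comp (Primrec.snd.comp hu))
    have h1 : Primrec₂ fun (p : List ℕ × List ℕ × List ℕ) (i : ℕ) => p.2.1.getD i 0 :=
      (Primrec.list_getD 0).comp (hf.comp Primrec.fst) Primrec.snd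
    have h2 : Primrec₂ fun (p : List ℕ × List ℕ × List ℕ) (i : ℕ) =>
        p.2.2.getD (Nat.pair (p.2.1.length - 1).unpair.1 i) 0 :=
      (Primrec.list_getD 0).comp (hs.comp Primrec.fst)
        (Primrec₂.natPair.comp (Primrec.fst.comp (hu.comp Primrec.fst)) Primrec.snd)
    exact hR.comp ((Primrec.list_cons.comp (Primrec.fst.comp hu) Primrec.fst).pair
      ((Primrec.list_map hr h1).pair (Primrec.list_map hr h2)))
  · have key : ∀ (g : ℕ → ℕ) (y l : ℕ),
        (List.range (l + 1)).map (fun i => (initialSegment f (Nat.pair y l)).getD i 0) =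
          initialSegment f l ∧
        (List.range (l + 1)).map (fun i => (initialSegment g (Nat.pair y l)).getD (Nat.pair y i) 0) =
          initialSegment (fun i => g (Nat.pair y i)) l := by
      refine fun g y l => ⟨map_range_getD_initialSegment (e := id) fun i hi =>
        hi.trans (Nat.right_le_pair y l), map_range_getD_initialSegment fun i hi => ?_⟩
      rcases hi.lt_or_eq with h | h
      · exact (Nat.pair_lt_pair_right y h).le
      · rw [h]
    simp only [hPR, length_initialSegment, Nat.add_sub_cancel]
    constructor
    · intro h
      choose g hg using h
      refine ⟨fun a => g a.unpair.1 a.unpair.2, fun m => ?_⟩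
      obtain ⟨y, l, rfl⟩ : ∃ y l, m = Nat.pair y l := ⟨_, _, (Nat.pair_unpair m).symm⟩
      rw [Nat.unpair_pair, (key 0 y l).1, (key _ y l).2]
      simpa using hg y l
    · rintro ⟨g, hg⟩ y
      refine ⟨fun i => g (Nat.pair y i), fun l => ?_⟩
      have := hg (Nat.pair y l)
      rwa [Nat.unpair_pair, (key g y l).1, (key g y l).2] at this

/-- The disjunction is an existential quantifier over a tag, `0` for the left side and nonzero for
the right. -/
theorem or (hP : HasClosedForm P) (hQ : HasClosedForm Q) :
    HasClosedForm fun x f => P x f ∨ Q x f := by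
  obtain ⟨R, hR, hPR⟩ := hP
  obtain ⟨S, hS, hQS⟩ := hQ
  refine (exists_cons (P := fun x f => (x.headI = 0 ∧ P x.tail f) ∨ (x.headI ≠ 0 ∧ Q x.tail f))
    ⟨fun p => (p.1.headI = 0 ∧ R (p.1.tail, p.2)) ∨ (p.1.headI ≠ 0 ∧ S (p.1.tail, p.2)),
      ?_, fun x f => ?_⟩).congr fun x f => ?_
  · have h0 : PrimrecPred fun p : List ℕ × List ℕ × List ℕ => p.1.headI = 0 :=
      Primrec.eq.comp (Primrec.list_headI.comp Primrec.fst) (Primrec.const 0)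
    have ht : Primrec fun p : List ℕ × List ℕ × List ℕ => (p.1.tail, p.2) :=
      (Primrec.list_tail.comp Primrec.fst).pair Primrec.snd
    exact .or (.and h0 (hR.comp ht)) (.and (.not h0) (hS.comp ht))
  · by_cases h : x.headI = 0 <;> simp [h, hPR, hQS]
  · constructor
    · rintro (h | h)
      · exact ⟨0, by simpa using h⟩
      · exact ⟨1, by simpa using h⟩
    · rintro ⟨y, ⟨-, h⟩ | ⟨-, h⟩⟩
      · exact Or.inl h
      · exact Or.inr h

end HasClosedForm

/-- The family of functions coded by a single function. -/
def unpackFunctions (k : ℕ) (f : ℕ → ℕ) : Fin k → ℕ → ℕ :=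
  fun i a => f (Nat.pair i a)

theorem unpackFunctions_surjective (k : ℕ) : Function.Surjective (unpackFunctions k) := by
  intro F
  refine ⟨fun a => if h : a.unpair.1 < k then F ⟨a.unpair.1, h⟩ a.unpair.2 else 0, ?_⟩
  funext i a
  simp [unpackFunctions]

/-- The value of a variable of a formula under the assignment of the entries of the list `x`; the
bound variables come first, the innermost one at the head. -/
def assignment (j : ℕ) (x : List ℕ) : Unit ⊕ Fin j → ℕ :=
  Sum.elim (fun _ => x.getD j 0) (fun i => x.getD (j - 1 - i) 0)

/-- A term queries `f` at finitely many arguments only. Short segments answer with the default `0`;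
once the segment covers all the queries the value is right. -/
theorem exists_primrec_eventually_eq_realize {k j : ℕ}
    (t : (arithLanguage k).Term (Unit ⊕ Fin j)) :
    ∃ e : List ℕ × List ℕ → ℕ, Primrec e ∧ ∀ x f, ∀ᶠ m in atTop,
      e (x, initialSegment f m) =
        @Language.Term.realize (arithLanguage k) ℕ (arithStructure (unpackFunctions k f)) _
          (assignment j x) t := by
  induction t with
  | var v =>
    rcases v with v | i
    · exact ⟨fun p => p.1.getD j 0, (Primrec.list_getD 0).comp Primrec.fst (Primrec.const j),
        fun x f => .of_forall fun m => rfl⟩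
    · exact ⟨fun p => p.1.getD (j - 1 - i) 0,
        (Primrec.list_getD 0).comp Primrec.fst (Primrec.const _),
        fun x f => .of_forall fun m => rfl⟩
  | func g ts ih =>
    choose e he hte using ih
    cases g with
    | zero => exact ⟨fun _ => 0, Primrec.const 0, fun x f => .of_forall fun m => rfl⟩
    | one => exact ⟨fun _ => 1, Primrec.const 1, fun x f => .of_forall fun m => rfl⟩
    | add =>
      refine ⟨fun p => e 0 p + e 1 p, Primrec.nat_add.comp (he 0) (he 1), fun x f => ?_⟩
      filter_upwards [hte 0 x f, hte 1 x f] with m h0 h1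
      rw [h0, h1]; rfl
    | mul =>
      refine ⟨fun p => e 0 p * e 1 p, Primrec.nat_mul.comp (he 0) (he 1), fun x f => ?_⟩
      filter_upwards [hte 0 x f, hte 1 x f] with m h0 h1
      rw [h0, h1]; rfl
    | var i =>
      refine ⟨fun p => p.2.getD (Nat.pair i (e 0 p)) 0, (Primrec.list_getD 0).comp Primrec.snd
        (Primrec₂.natPair.comp (Primrec.const _) (he 0)), fun x f => ?_⟩
      filter_upwards [hte 0 x f, eventually_ge_atTop (Nat.pair i
        (@Language.Term.realize (arithLanguage k) ℕ (arithStructure (unpackFunctions k f)) _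
          (assignment j x) (ts 0)))] with m h0 hm
      simp only [h0]
      rw [getD_initialSegment hm]; rfl

theorem snoc_assignment (j : ℕ) (x : List ℕ) (y : ℕ) :
    (Fin.snoc (fun i : Fin j => x.getD (j - 1 - i) 0) y : Fin (j + 1) → ℕ) =
      fun i : Fin (j + 1) => (y :: x).getD (j + 1 - 1 - i) 0 := by
  funext i
  refine Fin.lastCases ?_ (fun i => ?_) i
  · simp
  · have : j - (i : ℕ) = (j - 1 - i) + 1 := by omega
    simp [this]

/-- Closed forms are not closed under negation, so the formula and its negation are treated
simultaneously: implication needs both, and negation exchanges `forall_cons` with `exists_cons`.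
Atomic formulas are decided by a long enough segment, hence fall under `of_eventually` on both
sides. -/
theorem hasClosedForm_realize {k j : ℕ} (φ : (arithLanguage k).BoundedFormula Unit j) :
    (HasClosedForm fun x f => @Language.BoundedFormula.Realize (arithLanguage k) ℕ
      (arithStructure (unpackFunctions k f)) _ _ φ
      (fun _ => x.getD j 0) (fun i => x.getD (j - 1 - i) 0)) ∧
    (HasClosedForm fun x f => ¬ @Language.BoundedFormula.Realize (arithLanguage k) ℕ
      (arithStructure (unpackFunctions k f)) _ _ φ
      (fun _ => x.getD j 0) (fun i => x.getD (j - 1 - i) 0)) := by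
  classical
  have const (c : Prop) : HasClosedForm fun _ _ => c :=
    .of_eventually (r := fun _ => c) (Primrec.const (decide c) |> fun h => ⟨fun _ => _, h⟩)
      fun _ _ => .of_forall fun _ => Iff.rfl
  induction φ with
  | falsum => exact ⟨const False, const (¬ False)⟩
  | equal t₁ t₂ =>
    obtain ⟨e₁, he₁, h₁⟩ := exists_primrec_eventually_eq_realize t₁
    obtain ⟨e₂, he₂, h₂⟩ := exists_primrec_eventually_eq_realize t₂
    have he : PrimrecPred fun p => e₁ p = e₂ p := Primrec.eq.comp he₁ he₂
    constructor
    · refine .of_eventually he fun x f => ?_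
      filter_upwards [h₁ x f, h₂ x f] with m h₁ h₂
      rw [h₁, h₂]; rfl
    · refine .of_eventually he.not fun x f => ?_
      filter_upwards [h₁ x f, h₂ x f] with m h₁ h₂
      rw [h₁, h₂]; rfl
  | rel r => exact r.elim
  | imp φ ψ ihφ ihψ =>
    simp only [Language.BoundedFormula.realize_imp]
    exact ⟨(ihφ.2.or ihψ.1).congr fun x f => imp_iff_not_or,
      (ihφ.1.and ihψ.2).congr fun x f => Classical.not_imp⟩
  | all φ ih =>
    simp only [Language.BoundedFormula.realize_all, snoc_assignment, not_forall]
    exact ⟨ih.1.forall_cons, ih.2.exists_cons⟩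

theorem IsSigmaOneOne.exists_primrecPred {A : Set ℕ} (hA : IsSigmaOneOne A) :
    ∃ R : ℕ × List ℕ → Prop, PrimrecPred R ∧
      ∀ n, n ∈ A ↔ ∃ h, ∀ m, R (n, initialSegment h m) := by
  obtain ⟨k, φ, hφ⟩ := hA
  obtain ⟨R, hR, hφR⟩ := (hasClosedForm_realize φ).1
  refine ⟨fun p => R ([p.1], p.2.map (fun a => a.unpair.1), p.2.map fun a => a.unpair.2),
    ?_, fun n => ?_⟩
  · have h1 : Primrec₂ fun (_ : ℕ × List ℕ) (a : ℕ) => a.unpair.1 :=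
      Primrec.fst.comp (Primrec.unpair.comp Primrec.snd)
    have h2 : Primrec₂ fun (_ : ℕ × List ℕ) (a : ℕ) => a.unpair.2 :=
      Primrec.snd.comp (Primrec.unpair.comp Primrec.snd)
    exact hR.comp ((Primrec.list_cons.comp Primrec.fst (Primrec.const [])).pair
      ((Primrec.list_map Primrec.snd h1).pair (Primrec.list_map Primrec.snd h2)))
  · have hx (f : ℕ → ℕ) : @Language.Formula.Realize (arithLanguage k) ℕ
        (arithStructure (unpackFunctions k f)) Unit φ (fun _ => n) ↔
          ∃ g, ∀ m, R ([n], initialSegment f m, initialSegment g m) := by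
      have h0 (z z' : Fin 0 → ℕ) : @Language.BoundedFormula.Realize (arithLanguage k) ℕ
          (arithStructure (unpackFunctions k f)) Unit 0 φ (fun _ => n) z ↔
          @Language.BoundedFormula.Realize (arithLanguage k) ℕ
          (arithStructure (unpackFunctions k f)) Unit 0 φ (fun _ => n) z' := by
        rw [Subsingleton.elim z z']
      exact (h0 _ _).trans (hφR [n] f)
    simp only [map_initialSegment]
    rw [hφ, (unpackFunctions_surjective k).exists]
    constructor
    · rintro ⟨f, hf⟩
      obtain ⟨g, hg⟩ := (hx f).1 hf
      exact ⟨fun i => Nat.pair (f i) (g i), fun m => by simpa using hg m⟩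
    · rintro ⟨h, hh⟩
      exact ⟨_, (hx _).2 ⟨_, hh⟩⟩

/-! ## Positional winning strategies -/

/-- A player controlling the nodes in `ctrl` has a positional strategy `τ` with which he is never
stuck on the set `W`, containing `s`, which cannot be left against `τ`, and with which the visits
to `fin` during every infinite play inside `W` satisfy `Φ`. -/
def PositionallyWins (E : ℕ → ℕ → Prop) (ctrl fin : ℕ → Prop) (Φ : (ℕ → Prop) → Prop) (s : ℕ) :
    Prop :=
  ∃ (W : Set ℕ) (τ : ℕ → ℕ), s ∈ W ∧ (∀ u ∈ W, ctrl u → E u (τ u)) ∧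
    (∀ u ∈ W, ∀ v, E u v → (ctrl u → v = τ u) → v ∈ W) ∧
    ∀ v : ℕ → ℕ, (∀ i, v i ∈ W) → (∀ i, E (v i) (v (i + 1))) →
      (∀ i, ctrl (v i) → v (i + 1) = τ (v i)) → Φ fun i => fin (v i)

theorem getLastD_history (v : ℕ → ℕ) (n d : ℕ) :
    (BuchiGame.history v n).getLastD d = v n := by
  simp [BuchiGame.history, List.range_succ]

theorem BuchiGame.playerZeroWins_of_positionallyWins {G : BuchiGame}
    (h : PositionallyWins G.edge (· ∈ G.own) (· ∈ G.fin) (fun p => ∃ᶠ i in atTop, p i) G.start) :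
    G.PlayerZeroWins := by
  classical
  obtain ⟨W, τ, hs, hτ, hW, hΦ⟩ := h
  -- `τ` is legal only on `W`, whereas a strategy must be legal on every history; outside `W` an
  -- arbitrary successor repairs it.
  let next (u : ℕ) : ℕ :=
    if G.edge u (τ u) then τ u else if h : ∃ w, G.edge u w then h.choose else 0
  have next_eq (u : ℕ) (hu : u ∈ W) (ho : u ∈ G.own) : next u = τ u := if_pos (hτ u hu ho)
  have inv (v : ℕ → ℕ) (n : ℕ) (hv : G.IsFinitePlay v n)
      (hc : ∀ i < n, G.ConformsAt (fun l => next (l.getLastD 0)) v i) : ∀ i ≤ n, v i ∈ W := by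
    intro i
    induction i with
    | zero => exact fun _ => hv.1 ▸ hs
    | succ i ih =>
      intro hi
      refine hW _ (ih (by omega)) _ (hv.2 i hi) fun ho => ?_
      refine (hc i hi ho).trans ?_
      simp only [getLastD_history]
      rw [next_eq _ (ih (by omega)) ho]
  refine ⟨fun l => next (l.getLastD 0), fun v n _ _ hex => ?_, fun v n hv hc hex ho => ?_,
    fun v hv hc => ?_⟩
  · simp only [getLastD_history, next]
    split_ifs with h1
    · exact h1
    · exact hex.choose_spec
  · exact hex ⟨_, hτ _ (inv v n hv hc n le_rfl) ho⟩
  · have hvW (i : ℕ) : v i ∈ W :=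
      inv v i ⟨hv.1, fun j _ => hv.2 j⟩ (fun j _ => hc j) i le_rfl
    refine hΦ v hvW hv.2 fun i ho => ?_
    refine (hc i ho).trans ?_
    simp only [getLastD_history]
    rw [next_eq _ (hvW i) ho]

/-- Playing `σ` against `τ` determines one play. It never stops: on `W` player 1 always has the move
`τ`, and player 0 being stuck would refute `σ`. So it is infinite, and the two strategies make
contradictory claims about it. -/
theorem BuchiGame.not_playerZeroWins_of_positionallyWins {G : BuchiGame}
    (h : PositionallyWins G.edge (· ∉ G.own) (· ∈ G.fin)
      (fun p => ¬ ∃ᶠ i in atTop, p i) G.start) :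
    ¬ G.PlayerZeroWins := by
  classical
  obtain ⟨W, τ, hs, hτ, hW, hΦ⟩ := h
  rintro ⟨σ, hσ, hfin, hinf⟩
  let hist (n : ℕ) : List ℕ := Nat.rec [G.start]
    (fun _ l => l ++ [if l.getLastD 0 ∈ G.own then σ l else τ (l.getLastD 0)]) n
  let v (n : ℕ) : ℕ := (hist n).getLastD 0
  have hist_succ (n : ℕ) :
      hist (n + 1) = hist n ++ [if v n ∈ G.own then σ (hist n) else τ (v n)] := rfl
  have v_succ (n : ℕ) : v (n + 1) = if v n ∈ G.own then σ (hist n) else τ (v n) := by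
    simp [v, hist_succ n]
  have hist_eq (n : ℕ) : BuchiGame.history v n = hist n := by
    induction n with
    | zero => simp [BuchiGame.history, v, hist]
    | succ n ih =>
      rw [hist_succ, ← v_succ, ← ih]
      simp [BuchiGame.history, List.range_succ]
  have conf (i : ℕ) : G.ConformsAt σ v i := fun ho => by
    rw [v_succ, if_pos ho, hist_eq]
  have step (n : ℕ) (hp : G.IsFinitePlay v n) (hn : v n ∈ W) : G.edge (v n) (v (n + 1)) := by
    by_cases ho : v n ∈ G.own
    · rw [conf n ho]
      by_contra hcon
      exact hfin v n hp (fun i _ => conf i) (fun hex => hcon (hσ v n hp ho hex)) ho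
    · rw [v_succ, if_neg ho]
      exact hτ _ hn ho
  have play (n : ℕ) : G.IsFinitePlay v n ∧ v n ∈ W := by
    induction n with
    | zero => exact ⟨⟨rfl, fun i hi => absurd hi (Nat.not_lt_zero i)⟩, hs⟩
    | succ n ih =>
      have he := step n ih.1 ih.2
      refine ⟨⟨rfl, fun i hi => ?_⟩, hW _ ih.2 _ he fun ho => by rw [v_succ, if_neg ho]⟩
      rcases (Nat.lt_succ_iff.1 hi).lt_or_eq with hi | rfl
      · exact ih.1.2 i hi
      · exact he
  have hedge (i : ℕ) : G.edge (v i) (v (i + 1)) := step i (play i).1 (play i).2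
  exact hΦ v (fun i => (play i).2) hedge (fun i ho => by rw [v_succ, if_neg ho])
    (hinf v ⟨rfl, hedge⟩ conf)

/-! ## Games on trees -/

theorem positionallyWins_tree_of_branch {R : List ℕ → Prop} {ctrl fin : ℕ → Prop}
    {Φ : (ℕ → Prop) → Prop} (hctrl : ∀ u, ctrl u) (hΦ : ∀ v : ℕ → ℕ, Φ fun i => fin (v i))
    (h : ∃ f, ∀ m, R (initialSegment f m)) :
    PositionallyWins (fun u v => ∃ a, Denumerable.ofNat (List ℕ) v =
      a :: Denumerable.ofNat (List ℕ) u ∧ R (Denumerable.ofNat (List ℕ) v).reverse)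
      ctrl fin Φ 0 := by
  obtain ⟨f, hf⟩ := h
  have hsucc (m : ℕ) : f m :: ((List.range m).map f).reverse = (initialSegment f m).reverse := by
    simp [initialSegment, List.range_succ]
  -- A node codes a sequence with its newest entry at the head. `W` consists of the initial segments
  -- of the branch, including the empty one coded by `0`.
  refine ⟨{u | ∃ m, Denumerable.ofNat (List ℕ) u = ((List.range m).map f).reverse},
    fun u => Encodable.encode (f (Denumerable.ofNat (List ℕ) u).length ::
      Denumerable.ofNat (List ℕ) u), ⟨0, by simp⟩, ?_, ?_, fun v _ _ _ => hΦ v⟩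
  · rintro u ⟨m, hm⟩ -
    refine ⟨_, Denumerable.ofNat_encode _, ?_⟩
    rw [Denumerable.ofNat_encode, hm]
    simpa [hsucc] using hf m
  · rintro u ⟨m, hm⟩ v - hv
    refine ⟨m + 1, ?_⟩
    rw [hv (hctrl u), Denumerable.ofNat_encode, hm]
    simp [List.range_succ]

/-- `R` need not be closed under prefixes, so `W` records that all nonempty prefixes satisfy it. An
infinite play inside `W` would spell out a branch, whence `Φ` holds vacuously. -/
theorem positionallyWins_tree_of_no_branch {R : List ℕ → Prop} {ctrl fin : ℕ → Prop}
    {Φ : (ℕ → Prop) → Prop} (hctrl : ∀ u, ¬ ctrl u) (h : ¬ ∃ f, ∀ m, R (initialSegment f m)) :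
    PositionallyWins (fun u v => ∃ a, Denumerable.ofNat (List ℕ) v =
      a :: Denumerable.ofNat (List ℕ) u ∧ R (Denumerable.ofNat (List ℕ) v).reverse)
      ctrl fin Φ 0 := by
  refine ⟨{u | ∀ l, l ≠ [] → l <+: (Denumerable.ofNat (List ℕ) u).reverse → R l}, id,
    fun l hl hl' => (hl (by simpa using hl')).elim, fun u _ hu => (hctrl u hu).elim, ?_,
    fun v hv he _ => (h ?_).elim⟩
  · rintro u hu v ⟨a, ha, hR⟩ - l hl hlv
    rw [ha, List.reverse_cons, List.prefix_concat_iff] at hlv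
    rcases hlv with hlv | hlv
    · rwa [hlv, ← List.reverse_cons, ← ha]
    · exact hu l hl hlv
  · let L (i : ℕ) : List ℕ := (Denumerable.ofNat (List ℕ) (v i)).reverse
    have hL (i : ℕ) : ∃ a, L (i + 1) = L i ++ [a] := by
      obtain ⟨a, ha, -⟩ := he i
      exact ⟨a, by simp [L, ha]⟩
    have hlen (i : ℕ) : i ≤ (L i).length := by
      induction i with
      | zero => exact Nat.zero_le _
      | succ i ih => obtain ⟨a, ha⟩ := hL i; simpa [ha] using ih
    have hmono (i j : ℕ) (hij : i ≤ j) : L i <+: L j := by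
      induction j, hij using Nat.le_induction with
      | base => exact List.prefix_rfl
      | succ j _ ih => obtain ⟨a, ha⟩ := hL j; exact ih.trans (ha ▸ List.prefix_append _ _)
    -- The play may start anywhere in `W`, so the length of `L (i + 1)` is only known to be at least
    -- `i + 1`, enough to contain entry `i`.
    refine ⟨fun i => (L (i + 1)).getD i 0, fun m => hv (m + 1) _ ?_ ?_⟩
    · exact List.ne_nil_of_length_pos (by simp)
    · rw [List.prefix_iff_eq_take]
      refine List.ext_getElem ?_ fun i hi hi' => ?_
      · have := hlen (m + 1)
        simp only [L, List.length_reverse] at this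
        simpa using this
      · have hi : i ≤ m := by simpa [Nat.lt_succ_iff] using hi
        have h1 : i < (L (i + 1)).length := hlen (i + 1)
        simp only [initialSegment, List.getElem_map, List.getElem_range, List.getElem_take]
        rw [List.getD_eq_getElem _ _ h1]
        exact (hmono (i + 1) (m + 1) (by omega)).getElem h1

/-! ## Choosing between two games -/

/-- The copy of the node `w` in the component `c`. -/
def componentNode (c : Bool) (w : ℕ) : ℕ :=
  -- The shift by one keeps `0` free for the root of a choice.
  Nat.pair (c.toNat + 1) w

theorem componentNode_ne_zero (c : Bool) (w : ℕ) : componentNode c w ≠ 0 := by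
  intro h
  have := Nat.left_le_pair (c.toNat + 1) w
  rw [componentNode] at h
  omega

theorem componentNode_inj {c d : Bool} {u w : ℕ} :
    componentNode c u = componentNode d w ↔ c = d ∧ u = w := by
  rw [componentNode, componentNode, Nat.pair_eq_pair]
  cases c <;> cases d <;> simp

/-- `S` collects components that the player can win: one suffices if the root is his, otherwise all
are needed. After one step a play stays in a single component, so invariance of `Φ` under prepending
a step transfers the result. -/
theorem positionallyWins_of_components {E : Bool → ℕ → ℕ → Prop} {ctrl fin : Bool → ℕ → Prop}
    {E' : ℕ → ℕ → Prop} {ctrl' fin' : ℕ → Prop} {Φ : (ℕ → Prop) → Prop}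
    (hΦ : ∀ p : ℕ → Prop, Φ (fun i => p (i + 1)) → Φ p)
    (hroot : ∀ v, E' 0 v ↔ ∃ c, v = componentNode c 0)
    (hE : ∀ c u v, E' (componentNode c u) v ↔ ∃ w, v = componentNode c w ∧ E c u w)
    (hctrl : ∀ c u, ctrl' (componentNode c u) ↔ ctrl c u)
    (hfin : ∀ c u, fin' (componentNode c u) ↔ fin c u)
    {S : Set Bool} (hS : S.Nonempty) (hS' : ¬ ctrl' 0 → S = Set.univ)
    (h : ∀ c ∈ S, PositionallyWins (E c) (ctrl c) (fin c) Φ 0) :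
    PositionallyWins E' ctrl' fin' Φ 0 := by
  -- Components outside `S` receive a dummy region and strategy below, so that `choose` applies to
  -- all of `Bool`.
  classical
  obtain ⟨c₀, hc₀⟩ := hS
  have h' : ∀ c, ∃ (W : Set ℕ) (τ : ℕ → ℕ), c ∈ S → 0 ∈ W ∧ (∀ u ∈ W, ctrl c u → E c u (τ u)) ∧
      (∀ u ∈ W, ∀ v, E c u v → (ctrl c u → v = τ u) → v ∈ W) ∧
      ∀ v : ℕ → ℕ, (∀ i, v i ∈ W) → (∀ i, E c (v i) (v (i + 1))) →
        (∀ i, ctrl c (v i) → v (i + 1) = τ (v i)) → Φ fun i => fin c (v i) := by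
    intro c
    by_cases hc : c ∈ S
    · obtain ⟨W, τ, hW⟩ := h c hc
      exact ⟨W, τ, fun _ => hW⟩
    · exact ⟨∅, id, fun h => (hc h).elim⟩
  choose W τ hW using h'
  -- First coordinate `2` marks the component `true`.
  let τ' (u : ℕ) : ℕ := if u = 0 then componentNode c₀ 0 else
    Nat.pair u.unpair.1 (τ (decide (u.unpair.1 = 2)) u.unpair.2)
  have hτ' (c : Bool) (u : ℕ) : τ' (componentNode c u) = componentNode c (τ c u) := by
    simp only [τ', if_neg (componentNode_ne_zero c u)]
    cases c <;> simp [componentNode]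
  have hτ0 : τ' 0 = componentNode c₀ 0 := if_pos rfl
  refine ⟨{u | u = 0 ∨ ∃ c ∈ S, ∃ w ∈ W c, u = componentNode c w}, τ', Or.inl rfl, ?_, ?_, ?_⟩
  · rintro u (rfl | ⟨c, hc, w, hw, rfl⟩) hu
    · exact (hroot _).2 ⟨c₀, hτ0⟩
    · exact (hE _ _ _).2 ⟨_, hτ' c w, (hW c hc).2.1 w hw ((hctrl c w).1 hu)⟩
  · rintro u (rfl | ⟨c, hc, w, hw, rfl⟩) v hv hu
    · by_cases h0 : ctrl' 0
      · exact Or.inr ⟨c₀, hc₀, 0, (hW c₀ hc₀).1, (hu h0).trans hτ0⟩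
      · obtain ⟨c, rfl⟩ := (hroot v).1 hv
        have hc : c ∈ S := hS' h0 ▸ Set.mem_univ c
        exact Or.inr ⟨c, hc, 0, (hW c hc).1, rfl⟩
    · obtain ⟨w', rfl, hw'⟩ := (hE _ _ _).1 hv
      refine Or.inr ⟨c, hc, w', (hW c hc).2.2.1 w hw w' hw' fun hcw => ?_, rfl⟩
      have := hu ((hctrl c w).2 hcw)
      rw [hτ'] at this
      exact (componentNode_inj.1 this).2
  · intro v hvW hvE hvτ
    -- Time `1` is used because `v 0` may be the root, which is never reentered.
    obtain ⟨c, w₁, hv1⟩ : ∃ c w, v 1 = componentNode c w := by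
      rcases hvW 0 with h0 | ⟨c, -, w, -, h0⟩
      · obtain ⟨c, hc⟩ := (hroot _).1 (h0 ▸ hvE 0)
        exact ⟨c, 0, hc⟩
      · obtain ⟨w', hw', -⟩ := (hE c w _).1 (h0 ▸ hvE 0)
        exact ⟨c, w', hw'⟩
    have hv (i : ℕ) : ∃ w, v (i + 1) = componentNode c w := by
      induction i with
      | zero => exact ⟨w₁, hv1⟩
      | succ i ih =>
        obtain ⟨w, hw⟩ := ih
        obtain ⟨w', hw', -⟩ := (hE c w _).1 (hw ▸ hvE (i + 1))
        exact ⟨w', hw'⟩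
    choose w hw using hv
    have hmem (i : ℕ) : c ∈ S ∧ w i ∈ W c := by
      rcases hvW (i + 1) with h0 | ⟨d, hd, w', hw', h0⟩
      · exact (componentNode_ne_zero c (w i) (hw i ▸ h0)).elim
      · obtain ⟨rfl, rfl⟩ := componentNode_inj.1 ((hw i).symm.trans h0)
        exact ⟨hd, hw'⟩
    have := (hW c (hmem 0).1).2.2.2 w (fun i => (hmem i).2) (fun i => ?_) (fun i hi => ?_)
    · refine hΦ _ ?_
      simpa only [hw, hfin] using this
    · have := hvE (i + 1)
      rw [hw, hw, hE] at this
      obtain ⟨w', hw', hE'⟩ := this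
      rwa [(componentNode_inj.1 hw').2]
    · have := hvτ (i + 1)
      rw [hw, hw, hctrl, hτ'] at this
      exact (componentNode_inj.1 (this hi)).2

/-! ## Reductions to Büchi games -/

/-- A family of Büchi games on the natural numbers with starting node `0`, given by primitive
recursive predicates; the edge relation depends on a parameter, the first argument of `edge`. -/
structure GameFamily where
  own : ℕ → Prop
  fin : ℕ → Prop
  edge : ℕ × ℕ × ℕ → Prop
  own_primrec : PrimrecPred own
  fin_primrec : PrimrecPred fin
  edge_primrec : PrimrecPred edge

/-- The game of the family with parameter `n`. -/
def GameFamily.game (𝒢 : GameFamily) (n : ℕ) : BuchiGame where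
  node := Set.univ
  edge u v := 𝒢.edge (n, u, v)
  own := {u | 𝒢.own u}
  fin := {u | 𝒢.fin u}
  start := 0
  edge_mem _ _ _ := ⟨trivial, trivial⟩
  own_subset := Set.subset_univ _
  fin_subset := Set.subset_univ _
  start_mem := trivial

/-- Membership in `A` is decided by the winner of the games of a family, where moreover the winner
has a positional strategy. -/
def GameReducible (A : Set ℕ) : Prop :=
  ∃ 𝒢 : GameFamily, ∀ n,
    (n ∈ A → PositionallyWins (fun u v => 𝒢.edge (n, u, v)) 𝒢.own 𝒢.fin
      (fun p => ∃ᶠ i in atTop, p i) 0) ∧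
    (n ∉ A → PositionallyWins (fun u v => 𝒢.edge (n, u, v)) (fun u => ¬ 𝒢.own u) 𝒢.fin
      (fun p => ¬ ∃ᶠ i in atTop, p i) 0)

theorem PrimrecPred.const {α : Type*} [Primcodable α] (c : Prop) : PrimrecPred fun _ : α => c := by
  classical
  exact ⟨fun _ => inferInstance, Primrec.const (decide c)⟩

/-- The games in which one player builds a branch of a tree, and wins if he succeeds. It is player
`0` if `b` holds and player `1` otherwise. -/
def GameFamily.tree {R : ℕ × List ℕ → Prop} (hR : PrimrecPred R) (b : Prop) : GameFamily where
  own _ := b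
  fin _ := b
  edge p := ∃ a, Denumerable.ofNat (List ℕ) p.2.2 = a :: Denumerable.ofNat (List ℕ) p.2.1 ∧
    R (p.1, (Denumerable.ofNat (List ℕ) p.2.2).reverse)
  own_primrec := .const b
  fin_primrec := .const b
  edge_primrec := by
    have h1 : Primrec fun p : ℕ × ℕ × ℕ => Denumerable.ofNat (List ℕ) p.2.1 :=
      (Primrec.ofNat _).comp (Primrec.fst.comp Primrec.snd)
    have h2 : Primrec fun p : ℕ × ℕ × ℕ => Denumerable.ofNat (List ℕ) p.2.2 :=
      (Primrec.ofNat _).comp (Primrec.snd.comp Primrec.snd)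
    -- The quantifier over `a` needs no search: `a` can only be the head of the new list.
    refine (PrimrecPred.and (Primrec.eq.comp h2
      (Primrec.list_cons.comp (Primrec.list_headI.comp h2) h1))
      (hR.comp (Primrec.fst.pair (Primrec.list_reverse.comp h2)))).of_eq fun p => ?_
    constructor
    · rintro ⟨h, h'⟩
      exact ⟨_, h, h'⟩
    · rintro ⟨a, h, h'⟩
      exact ⟨by rw [h]; rfl, h'⟩

theorem IsSigmaOneOne.gameReducible {A : Set ℕ} (hA : IsSigmaOneOne A) : GameReducible A := by
  obtain ⟨R, hR, hAR⟩ := hA.exists_primrecPred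
  refine ⟨.tree hR True, fun n => ⟨fun hn => ?_, fun hn => ?_⟩⟩
  · exact positionallyWins_tree_of_branch (R := fun l => R (n, l)) (fun _ => trivial)
      (fun _ => Frequently.of_forall fun _ => trivial) ((hAR n).1 hn)
  · exact positionallyWins_tree_of_no_branch (R := fun l => R (n, l)) (fun _ h => h trivial) (mt (hAR n).2 hn)

/-- Player 1 builds the branch and no node accepts: an infinite play is lost for player 0, and
getting stuck is lost for player 1. -/
theorem IsSigmaOneOne.gameReducible_compl {A : Set ℕ} (hA : IsSigmaOneOne A) :
    GameReducible Aᶜ := by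
  obtain ⟨R, hR, hAR⟩ := hA.exists_primrecPred
  refine ⟨.tree hR False, fun n => ⟨fun hn => ?_, fun hn => ?_⟩⟩
  · exact positionallyWins_tree_of_no_branch (R := fun l => R (n, l)) (fun _ => id) (mt (hAR n).2 hn)
  · exact positionallyWins_tree_of_branch (R := fun l => R (n, l)) (fun _ => id)
      (fun _ => by simp [GameFamily.tree]) ((hAR n).1 (not_not.1 hn))

theorem PrimrecPred.exists_componentNode_and {p : Bool → ℕ → Prop} (hp : ∀ c, PrimrecPred (p c)) :
    PrimrecPred fun u => ∃ c w, u = componentNode c w ∧ p c w := by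
  have h1 : Primrec fun u : ℕ => u.unpair.1 := Primrec.fst.comp Primrec.unpair
  have h2 : Primrec fun u : ℕ => u.unpair.2 := Primrec.snd.comp Primrec.unpair
  refine (PrimrecPred.or
    (.and (Primrec.eq.comp h1 (Primrec.const 1)) ((hp false).comp h2))
    (.and (Primrec.eq.comp h1 (Primrec.const 2)) ((hp true).comp h2))).of_eq fun u => ?_
  constructor
  · rintro (⟨h, h'⟩ | ⟨h, h'⟩)
    · exact ⟨false, _, by rw [← Nat.pair_unpair u, h]; simp [componentNode], h'⟩
    · exact ⟨true, _, by rw [← Nat.pair_unpair u, h]; simp [componentNode], h'⟩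
  · rintro ⟨c, w, rfl, h⟩
    cases c <;> simpa [componentNode] using h

/-- The games in which first one player, player `0` if `b` holds and player `1` otherwise, chooses
one of two games, which is played then. -/
def GameFamily.choice (𝒢 : Bool → GameFamily) (b : Prop) : GameFamily where
  own u := (u = 0 ∧ b) ∨ ∃ c w, u = componentNode c w ∧ (𝒢 c).own w
  fin u := ∃ c w, u = componentNode c w ∧ (𝒢 c).fin w
  edge p := (p.2.1 = 0 ∧ ∃ c, p.2.2 = componentNode c 0) ∨
    ∃ c u w, p.2.1 = componentNode c u ∧ p.2.2 = componentNode c w ∧ (𝒢 c).edge (p.1, u, w)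
  own_primrec := .or (.and (Primrec.eq.comp Primrec.id (Primrec.const 0)) (.const b))
    (.exists_componentNode_and fun c => (𝒢 c).own_primrec)
  fin_primrec := .exists_componentNode_and fun c => (𝒢 c).fin_primrec
  edge_primrec := by
    have h1 : Primrec fun p : ℕ × ℕ × ℕ => p.2.1.unpair :=
      Primrec.unpair.comp (Primrec.fst.comp Primrec.snd)
    have h2 : Primrec fun p : ℕ × ℕ × ℕ => p.2.2.unpair :=
      Primrec.unpair.comp (Primrec.snd.comp Primrec.snd)
    have hc (c : Bool) : PrimrecPred fun p : ℕ × ℕ × ℕ => p.2.1.unpair.1 = c.toNat + 1 ∧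
        p.2.2.unpair.1 = c.toNat + 1 ∧ (𝒢 c).edge (p.1, p.2.1.unpair.2, p.2.2.unpair.2) :=
      .and (Primrec.eq.comp (Primrec.fst.comp h1) (Primrec.const _))
        (.and (Primrec.eq.comp (Primrec.fst.comp h2) (Primrec.const _))
          ((𝒢 c).edge_primrec.comp
            (Primrec.fst.pair ((Primrec.snd.comp h1).pair (Primrec.snd.comp h2)))))
    have hr (c : Bool) : PrimrecPred fun p : ℕ × ℕ × ℕ => p.2.2 = componentNode c 0 :=
      Primrec.eq.comp (Primrec.snd.comp Primrec.snd) (Primrec.const _)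
    refine (PrimrecPred.or (.and (Primrec.eq.comp (Primrec.fst.comp Primrec.snd)
      (Primrec.const 0)) (.or (hr false) (hr true))) (.or (hc false) (hc true))).of_eq fun p => ?_
    have hcomp (c : Bool) (u w : ℕ) : u = componentNode c w ↔
        u.unpair.1 = c.toNat + 1 ∧ u.unpair.2 = w := by
      rw [componentNode, ← Nat.pair_eq_pair, Nat.pair_unpair]
    refine or_congr (by simp) ?_
    simp only [hcomp, Bool.exists_bool]
    refine or_congr ?_ ?_
    all_goals
      constructor
      · rintro ⟨h, h', h''⟩
        exact ⟨_, _, ⟨h, rfl⟩, ⟨h', rfl⟩, h''⟩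
      · rintro ⟨_, _, ⟨h, rfl⟩, ⟨h', rfl⟩, h''⟩
        exact ⟨h, h', h''⟩

namespace GameFamily

variable (𝒢 : Bool → GameFamily) (b : Prop)

theorem choice_own_zero : (choice 𝒢 b).own 0 ↔ b := by
  simp [choice, (componentNode_ne_zero _ _).symm]

theorem choice_own_componentNode (c : Bool) (u : ℕ) :
    (choice 𝒢 b).own (componentNode c u) ↔ (𝒢 c).own u := by
  simp only [choice, componentNode_ne_zero, false_and, false_or, componentNode_inj]
  constructor
  · rintro ⟨_, _, ⟨rfl, rfl⟩, h⟩
    exact h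
  · exact fun h => ⟨_, _, ⟨rfl, rfl⟩, h⟩

theorem choice_fin_componentNode (c : Bool) (u : ℕ) :
    (choice 𝒢 b).fin (componentNode c u) ↔ (𝒢 c).fin u := by
  simp only [choice, componentNode_inj]
  constructor
  · rintro ⟨_, _, ⟨rfl, rfl⟩, h⟩
    exact h
  · exact fun h => ⟨_, _, ⟨rfl, rfl⟩, h⟩

theorem choice_edge_zero (n v : ℕ) :
    (choice 𝒢 b).edge (n, 0, v) ↔ ∃ c, v = componentNode c 0 := by
  simp [choice, (componentNode_ne_zero _ _).symm]

theorem choice_edge_componentNode (n : ℕ) (c : Bool) (u v : ℕ) :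
    (choice 𝒢 b).edge (n, componentNode c u, v) ↔
      ∃ w, v = componentNode c w ∧ (𝒢 c).edge (n, u, w) := by
  simp only [choice, componentNode_ne_zero, false_and, false_or, componentNode_inj]
  constructor
  · rintro ⟨_, _, w, ⟨rfl, rfl⟩, h⟩
    exact ⟨w, h⟩
  · rintro ⟨w, h⟩
    exact ⟨_, _, w, ⟨rfl, rfl⟩, h⟩

end GameFamily

theorem frequently_of_frequently_succ {p : ℕ → Prop} (h : ∃ᶠ i in atTop, p (i + 1)) :
    ∃ᶠ i in atTop, p i :=
  (tendsto_add_atTop_nat 1).frequently h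

theorem not_frequently_of_not_frequently_succ {p : ℕ → Prop}
    (h : ¬ ∃ᶠ i in atTop, p (i + 1)) : ¬ ∃ᶠ i in atTop, p i := by
  rw [not_frequently] at h ⊢
  rw [← map_add_atTop_eq_nat 1]
  exact eventually_map.2 h

theorem GameReducible.union {A B : Set ℕ} (hA : GameReducible A) (hB : GameReducible B) :
    GameReducible (A ∪ B) := by
  obtain ⟨𝒢, h𝒢⟩ := hA
  obtain ⟨ℋ, hℋ⟩ := hB
  let 𝒦 (c : Bool) : GameFamily := if c then ℋ else 𝒢
  refine ⟨.choice 𝒦 True, fun n => ⟨fun hn => ?_, fun hn => ?_⟩⟩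
  · refine positionallyWins_of_components (fun _ => frequently_of_frequently_succ)
      (GameFamily.choice_edge_zero 𝒦 True n) (GameFamily.choice_edge_componentNode 𝒦 True n)
      (GameFamily.choice_own_componentNode 𝒦 True) (GameFamily.choice_fin_componentNode 𝒦 True)
      (S := {c | n ∈ if c then B else A}) ?_
      (fun h => (h ((GameFamily.choice_own_zero 𝒦 True).2 trivial)).elim) ?_
    · rcases hn with hn | hn
      · exact ⟨false, hn⟩
      · exact ⟨true, hn⟩
    · rintro (_ | _) hc
      · exact (h𝒢 n).1 hc
      · exact (hℋ n).1 hc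
  · refine positionallyWins_of_components (fun _ => not_frequently_of_not_frequently_succ)
      (GameFamily.choice_edge_zero 𝒦 True n) (GameFamily.choice_edge_componentNode 𝒦 True n)
      (fun c u => not_congr (GameFamily.choice_own_componentNode 𝒦 True c u))
      (GameFamily.choice_fin_componentNode 𝒦 True) Set.univ_nonempty (fun _ => rfl) ?_
    rintro (_ | _) -
    · exact (h𝒢 n).2 fun h => hn (Or.inl h)
    · exact (hℋ n).2 fun h => hn (Or.inr h)

theorem GameReducible.inter {A B : Set ℕ} (hA : GameReducible A) (hB : GameReducible B) :
    GameReducible (A ∩ B) := by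
  obtain ⟨𝒢, h𝒢⟩ := hA
  obtain ⟨ℋ, hℋ⟩ := hB
  let 𝒦 (c : Bool) : GameFamily := if c then ℋ else 𝒢
  refine ⟨.choice 𝒦 False, fun n => ⟨fun hn => ?_, fun hn => ?_⟩⟩
  · refine positionallyWins_of_components (fun _ => frequently_of_frequently_succ)
      (GameFamily.choice_edge_zero 𝒦 False n) (GameFamily.choice_edge_componentNode 𝒦 False n)
      (GameFamily.choice_own_componentNode 𝒦 False) (GameFamily.choice_fin_componentNode 𝒦 False)
      Set.univ_nonempty (fun _ => rfl) ?_
    rintro (_ | _) -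
    · exact (h𝒢 n).1 hn.1
    · exact (hℋ n).1 hn.2
  · refine positionallyWins_of_components (fun _ => not_frequently_of_not_frequently_succ)
      (GameFamily.choice_edge_zero 𝒦 False n) (GameFamily.choice_edge_componentNode 𝒦 False n)
      (fun c u => not_congr (GameFamily.choice_own_componentNode 𝒦 False c u))
      (GameFamily.choice_fin_componentNode 𝒦 False)
      -- Player 1 moves to a component whose set omits `n`.
      (S := {c | n ∉ if c then B else A}) ?_
      (fun h => (h (GameFamily.choice_own_zero 𝒦 False).1).elim) ?_
    · by_cases h : n ∈ A
      · exact ⟨true, fun h' => hn ⟨h, h'⟩⟩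
      · exact ⟨false, h⟩
    · rintro (_ | _) hc
      · exact (h𝒢 n).2 hc
      · exact (hℋ n).2 hc

theorem isSigmaOneOne_empty : IsSigmaOneOne ∅ :=
  ⟨0, ⊥, fun _ => iff_of_false (Set.notMem_empty _) fun ⟨_, h⟩ => h⟩

theorem gameReducible_of_mem_booleanSigmaOneOne {A : Set ℕ} (hA : A ∈ BooleanSigmaOneOne) :
    GameReducible A ∧ GameReducible Aᶜ := by
  refine BooleanSubalgebra.closure_bot_sup_induction
    (p := fun A _ => GameReducible A ∧ GameReducible Aᶜ)
    (fun A hA => ⟨hA.gameReducible, hA.gameReducible_compl⟩)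
    ⟨isSigmaOneOne_empty.gameReducible, isSigmaOneOne_empty.gameReducible_compl⟩
    (fun A _ B _ hA hB => ⟨hA.1.union hB.1, ?_⟩)
    (fun A _ hA => ⟨hA.2, (compl_compl A).symm ▸ hA.1⟩) hA
  rw [compl_sup]
  exact hA.2.inter hB.2

/-! ## Programs for the games -/

theorem PrimrecPred.exists_code {p : ℕ → Prop} (hp : PrimrecPred p) :
    ∃ c : Nat.Partrec.Code, (∀ n, p n → c.eval n = Part.some 1) ∧
      ∀ n, ¬ p n → c.eval n = Part.some 0 := by
  classical
  have h : Primrec fun n => if p n then 1 else 0 :=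
    Primrec.ite hp (Primrec.const 1) (Primrec.const 0)
  obtain ⟨c, hc⟩ := Nat.Partrec.Code.exists_code.1 (Partrec.nat_iff.1 h.to_comp)
  refine ⟨c, fun n hn => ?_, fun n hn => ?_⟩
  · simp [hc, hn]
  · simp [hc, hn]

theorem Decides.unique {c : Nat.Partrec.Code} {S T : Set ℕ} (hS : Decides c S) (hT : Decides c T) :
    S = T := by
  ext n
  by_cases h : n ∈ S <;> by_cases h' : n ∈ T
  · exact iff_of_true h h'
  · have := ((hS n).1 h).symm.trans ((hT n).2 h')
    simp at this
  · have := ((hS n).2 h).symm.trans ((hT n).1 h')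
    simp at this
  · exact iff_of_false h h'

/-- `RBGProblem` only asserts that some described game is won; uniqueness identifies it with the
constructed one. -/
theorem Describes.unique {d : GameDescription} {G H : BuchiGame} (hG : Describes d G)
    (hH : Describes d H) : G = H := by
  have hnode := hG.1.unique hH.1
  have hedge : G.edge = H.edge := by
    funext u v
    have := Set.ext_iff.1 (hG.2.1.unique hH.2.1) (Nat.pair u v)
    simpa using this
  have hown := hG.2.2.1.unique hH.2.2.1
  have hfin := hG.2.2.2.1.unique hH.2.2.2.1
  have hstart := hG.2.2.2.2.symm.trans hH.2.2.2.2
  cases G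
  cases H
  cases hnode
  cases hedge
  cases hown
  cases hfin
  cases hstart
  rfl

theorem GameFamily.exists_computable_describes (𝒢 : GameFamily) :
    ∃ f : ℕ → GameDescription, Computable f ∧ ∀ n, Describes (f n) (𝒢.game n) := by
  obtain ⟨cn, hcn, -⟩ := (PrimrecPred.const (α := ℕ) True).exists_code
  obtain ⟨co, hco, hco'⟩ := 𝒢.own_primrec.exists_code
  obtain ⟨cf, hcf, hcf'⟩ := 𝒢.fin_primrec.exists_code
  have he : PrimrecPred fun a : ℕ => 𝒢.edge (a.unpair.1, a.unpair.2.unpair) :=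
    𝒢.edge_primrec.comp ((Primrec.fst.comp Primrec.unpair).pair
      (Primrec.unpair.comp (Primrec.snd.comp Primrec.unpair)))
  obtain ⟨ce, hce, hce'⟩ := he.exists_code
  -- `ce` decides edges with `n` as part of its input; `curry` hard-wires `n` into the program,
  -- primitive recursively in `n`.
  refine ⟨fun n => (cn, ce.curry n, co, cf, 0), Primrec.to_comp ?_, fun n => ⟨?_, ?_, ?_, ?_, rfl⟩⟩
  · exact (Primrec.const cn).pair ((Nat.Partrec.Code.primrec₂_curry.comp (Primrec.const ce)
      Primrec.id).pair (Primrec.const (co, cf, 0)))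
  · exact fun m => ⟨fun _ => hcn m trivial, fun h => (h trivial).elim⟩
  · refine fun m => ⟨fun h => ?_, fun h => ?_⟩
    · rw [Nat.Partrec.Code.eval_curry]
      exact hce _ (by simp only [Nat.unpair_pair]; exact h)
    · rw [Nat.Partrec.Code.eval_curry]
      exact hce' _ (by simp only [Nat.unpair_pair]; exact h)
  · exact fun m => ⟨hco m, hco' m⟩
  · exact fun m => ⟨hcf m, hcf' m⟩

/-- Every Boolean combination of `Σ¹₁` sets is many-one reducible to the recursive Büchi game
problem, by a reduction all of whose values are descriptions of recursive Büchi games. -/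
theorem mainTheorem3 (A : Set ℕ) (hA : A ∈ BooleanSigmaOneOne) :
    ∃ f : ℕ → GameDescription, Computable f ∧
      (∀ n : ℕ, IsRecursiveBuchiGame (f n)) ∧
      (∀ n : ℕ, n ∈ A ↔ RBGProblem (f n)) := by
  obtain ⟨𝒢, h𝒢⟩ := (gameReducible_of_mem_booleanSigmaOneOne hA).1
  obtain ⟨f, hf, hf𝒢⟩ := 𝒢.exists_computable_describes
  refine ⟨f, hf, fun n => ⟨_, hf𝒢 n⟩, fun n => ⟨fun hn => ⟨_, hf𝒢 n, ?_⟩, ?_⟩⟩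
  · exact BuchiGame.playerZeroWins_of_positionallyWins ((h𝒢 n).1 hn)
  · rintro ⟨G, hG, hwin⟩
    by_contra hn
    rw [hG.unique (hf𝒢 n)] at hwin
    exact BuchiGame.not_playerZeroWins_of_positionallyWins ((h𝒢 n).2 hn) hwin
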